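/- **Setting.** A finite alternating transition system $T=(Q,A,B,\to,O,H)$ consists of finite sets $Q$ (states), $A$ (control labels), $B$ (disturbance labels), a relation ${\to}\subseteq Q\times A\times B\times Q$, and an observation function $H:Q\to O$. It is non-blocking if for all $q,a,b$ there is $q'$ with $q\xrightarrow{a,b}q'$. A control strategy is a function $f:Q^+\to A$ on non-empty finite strings, and $$\mathrm{Out}(q,f)=\{\sigma\in Q^\omega:\ \sigma[1]=q,\ \forall i\ge 1\ \exists b\in B:\ \sigma[i]\xrightarrow{f(\sigma[1]\cdots\sigma[i]),\,b}\sigma[i+1]\}.$$ Formulas of $\mathrm{LTL}_{-X}(\mathbb P)$, $\mathbb P$ a finite set of atomic propositions, are $\varphi::=p\mid\neg\varphi\mid\varphi_1\wedge\varphi_2\mid\varphi_1\mathbf U\varphi_2$ with the usual semantics over infinite words over $2^{\mathbb P}$. For a valuation $\Pi:Q\to2^{\mathbb P}$, $\sigma\in Q^\omega$ satisfies $\varphi$ ($\sigma\models\varphi$) if the word $\Pi(\sigma[1])\Pi(\sigma[2])\cdots$ satisfies $\varphi$ at its first position. Write $q\xrightarrow{a}q'$ if $q\xrightarrow{a,b}q'$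 for some $b\in B$. The reactive agent $(q_0,succ_T)$ starts in $q_0$ and can execute every $a\in A$ in every state $q$ (with duration $1$), with nondeterministic successors $\{q':q\xrightarrow{a}q'\}$. A reactive plan of $(q_0,succ_T)$ is a finite list of rules $(i,q_i,a_i,N_i)$, $1\le i\le k$, $k\ge1$, with $q_i\in Q$, $a_i\in A$, $N_i\subseteq\{1,\dots,k\}$, such that $q_1=q_0$, $q_i\xrightarrow{a_i}q_j$ for all $j\in N_i$, and whenever $q_i\xrightarrow{a_i}q'$ there is $j\in N_i$ with $q_j=q'$. It generates the trajectories $q_{i_1}q_{i_2}\cdots$ with $i_1=1$ and $i_{n+1}\in N_{i_n}$ for all $n$. It enforces $\varphi$ if all its trajectories satisfy $\varphi$ and it has at least one trajectory. **The control strategy algorithm** on input $T,\varphi,\Pi$ goes through the states $q_0\in Q$ in some order. For each $q_0$, the planning step looks for a reactive plan of $(q_0,succ_T)$ enforcing $\varphi$ with respect to $\Pi$. If none is found, the algorithm goes on with the next state. If some such plan $RP_{kab}$ is found, it is simplified to a plan $RP$, and $q_0$ and the strategy $f_{RP}$ are returned, where: * *Simplification.* A path is a sequence of at least two plan states, each next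 one lying in $N_i$ for the preceding one $i$. Take the first plan state $i$ for which there are a path from $i$ to $i$ and a path from $1$ to $i$; let *suffix* and *prefix* be shortest paths from $i$ to $i$ and from $1$ to $i$. Then in each $N_i$, from each class of plan states $j\in N_i$ with a common label $q_j$, keep exactly one element and remove the others: a $j$ that follows $i$ immediately in *prefix* if the class contains one, otherwise a $j$ that follows $i$ immediately in *suffix* if the class contains one, otherwise an arbitrary element. * *Strategy.* $f_{RP}(s)$ is computed by following $s$ through $RP$: if $s[1]\ne q_1$, the value is $a_1$. Otherwise start in plan state $1$ and, for $n=2,\dots,|s|$, move from the current plan state $i$ to a $j\in N_i$ with $q_j=s[n]$; if there is none, the value is $a_1$. If all of $s$ is read, the value is $a_i$ for the plan state $i$ reached. If no state yields a plan, the algorithm returns "false". **Theorem (correctness).** Let $T$ be a finite, non-blocking alternating transition system, $\varphi$ an $\mathrm{LTL}_{-X}(\mathbb P)$ formula and $\Pi:Q\to2^{\mathbb P}$ a valuation. If the control strategy algorithm on input $T,\varphi,\Pi$ returns a state $q_0$ and a control strategy $f_{RP}$, then $\sigma\models\varphi$ for every $\sigma\in\mathrm{Out}(q_0,f_{RP})$.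 -/

import Mathlib

/-! ### LTL without the next operator -/

/-- Formulas `φ ::= p | ¬φ | φ₁ ∧ φ₂ | φ₁ U φ₂` over the atomic propositions `P`. -/
inductive LTLX (P : Type*) where
  | atom (p : P) : LTLX P
  | neg (φ : LTLX P) : LTLX P
  | and (φ ψ : LTLX P) : LTLX P
  | until (φ ψ : LTLX P) : LTLX P

/-- `φ.HoldsAt w i`: the infinite word `w` over `2^P` satisfies `φ` at position `i`.
Positions of infinite words are counted from `0`. -/
def LTLX.HoldsAt {P : Type*} (w : ℕ → Set P) : LTLX P → ℕ → Prop
  | .atom p, i => p ∈ w i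
  | .neg φ, i => ¬ φ.HoldsAt w i
  | .and φ ψ, i => φ.HoldsAt w i ∧ ψ.HoldsAt w i
  | .until φ ψ, i => ∃ j, i ≤ j ∧ ψ.HoldsAt w j ∧ ∀ k, i ≤ k → k < j → φ.HoldsAt w k

/-- The infinite sequence of states `σ` satisfies `φ` with respect to the valuation `val`. -/
def LTLX.SatisfiedBy {Q P : Type*} (φ : LTLX P) (val : Q → Set P) (σ : ℕ → Q) : Prop :=
  φ.HoldsAt (fun i => val (σ i)) 0

/-! ### Alternating transition systems and control strategies -/

/-- An alternating transition system with states `Q`, control labels `A`, disturbance labels `B`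
and observations `O`; `trans q a b q'` means `q --(a,b)--> q'`. -/
structure AlternatingTS (Q A B O : Type*) where
  trans : Q → A → B → Q → Prop
  obs : Q → O

/-- Every `q`, `a`, `b` admits a successor. -/
def AlternatingTS.NonBlocking {Q A B O : Type*} (T : AlternatingTS Q A B O) : Prop :=
  ∀ q a b, ∃ q', T.trans q a b q'

/-- Control strategies `f : Q⁺ → A` on non-empty finite strings of states. -/
abbrev ControlStrategy (Q A : Type*) := {s : List Q // s ≠ []} → A

/-- The non-empty prefix `σ 0, …, σ i` of an infinite sequence. -/
def seqPrefix {Q : Type*} (σ : ℕ → Q) (i : ℕ) : {s : List Q // s ≠ []} :=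
  ⟨(List.range (i + 1)).map σ, by simp⟩

/-- The outcome `Out(q, f)`: the infinite sequences from `q` that follow the strategy `f`. -/
def AlternatingTS.Out {Q A B O : Type*} (T : AlternatingTS Q A B O) (q : Q)
    (f : ControlStrategy Q A) : Set (ℕ → Q) :=
  {σ | σ 0 = q ∧ ∀ i, ∃ b, T.trans (σ i) (f (seqPrefix σ i)) b (σ (i + 1))}

/-! ### Reactive agents and reactive plans -/

/-- A reactive agent `(q₀, succ)`: `succ q` lists the triples `(a, d, W)` of an action executable
in `q`, its positive duration, and its set of nondeterministic successors. -/
structure ReactiveAgent (Q A : Type*) where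
  init : Q
  succ : Q → List (A × {d : ℝ // 0 < d} × Set Q)

/-- The action `a` is executable in `q`. -/
def ReactiveAgent.Executable {Q A : Type*} (R : ReactiveAgent Q A) (q : Q) (a : A) : Prop :=
  ∃ d W, (a, d, W) ∈ R.succ q

/-- `q --a--> q'`. -/
def ReactiveAgent.Step {Q A : Type*} (R : ReactiveAgent Q A) (q : Q) (a : A) (q' : Q) : Prop :=
  ∃ d W, (a, d, W) ∈ R.succ q ∧ q' ∈ W

/-- The transition function `succ_T` of an alternating transition system: each control label `a`
has duration `1` and successors `{q' | q --(a,b)--> q' for some b}`. -/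
noncomputable def AlternatingTS.succFun {Q A B O : Type*} [Fintype A]
    (T : AlternatingTS Q A B O) (q : Q) : List (A × {d : ℝ // 0 < d} × Set Q) :=
  (Finset.univ : Finset A).toList.map
    fun a => (a, ⟨1, one_pos⟩, {q' | ∃ b, T.trans q a b q'})

/-- The reactive agent `(q₀, succ_T)`. -/
noncomputable def AlternatingTS.agent {Q A B O : Type*} [Fintype A]
    (T : AlternatingTS Q A B O) (q₀ : Q) : ReactiveAgent Q A :=
  ⟨q₀, T.succFun⟩

/-- A family of situation control rules `(i, world i, act i, next i)`, one for each plan state.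
There are `k + 1` plan states, numbered `0, …, k`; the initial plan state is `0`. -/
structure PlanRules (Q A : Type*) where
  k : ℕ
  world : Fin (k + 1) → Q
  act : Fin (k + 1) → A
  next : Fin (k + 1) → Set (Fin (k + 1))

/-- The rules form a reactive plan of the agent `R`: the initial plan state is labelled by the
initial world state; the action of each rule is executable in its world state; the plan states in
`next i` are labelled by successors of `world i` under `act i`, and each such successor labels at
least one of them. -/
structure PlanRules.IsReactivePlan {Q A : Type*} (RP : PlanRules Q A)
    (R : ReactiveAgent Q A) : Prop where
  world_init : RP.world 0 = R.init
  executable : ∀ i, R.Executable (RP.world i) (RP.act i)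
  step_of_next : ∀ i, ∀ j ∈ RP.next i, R.Step (RP.world i) (RP.act i) (RP.world j)
  next_of_step : ∀ i q', R.Step (RP.world i) (RP.act i) q' → ∃ j ∈ RP.next i, RP.world j = q'

/-- `σ` is a trajectory generated by the plan. -/
def PlanRules.Generates {Q A : Type*} (RP : PlanRules Q A) (σ : ℕ → Q) : Prop :=
  ∃ n : ℕ → Fin (RP.k + 1), n 0 = 0 ∧ ∀ j, n (j + 1) ∈ RP.next (n j) ∧ RP.world (n j) = σ j

/-- The plan satisfies (enforces) `φ`: all its trajectories satisfy `φ`, and it has one. -/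
def PlanRules.Satisfies {Q A P : Type*} (RP : PlanRules Q A) (φ : LTLX P)
    (val : Q → Set P) : Prop :=
  (∀ σ, RP.Generates σ → φ.SatisfiedBy val σ) ∧ ∃ σ, RP.Generates σ

/-! ### Simplifying a reactive plan -/

/-- `s` is a finite path of the plan (with at least two entries) from `i` to `j`. -/
def PlanRules.IsPath {Q A : Type*} (RP : PlanRules Q A) (i j : Fin (RP.k + 1))
    (s : List (Fin (RP.k + 1))) : Prop :=
  1 < s.length ∧ s.IsChain (fun a b => b ∈ RP.next a) ∧ s.head? = some i ∧ s.getLast? = some j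

/-- `s` is a shortest path from `i` to `j`. -/
def PlanRules.IsShortestPath {Q A : Type*} (RP : PlanRules Q A) (i j : Fin (RP.k + 1))
    (s : List (Fin (RP.k + 1))) : Prop :=
  RP.IsPath i j s ∧ ∀ s', RP.IsPath i j s' → s.length ≤ s'.length

/-- `i` lies on a cycle and can be reached from the initial plan state by a path. -/
def PlanRules.OnReachableCycle {Q A : Type*} (RP : PlanRules Q A) (i : Fin (RP.k + 1)) : Prop :=
  (∃ s, RP.IsPath i i s) ∧ ∃ s, RP.IsPath 0 i s

/-- Possible results of the search loop: for the first plan state `i` on a reachable cycle,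
`suf` is a shortest path from `i` to `i` and `pre` a shortest path from the initial plan state
to `i`.  If there is no such `i`, the search fails and `pre`, `suf` are not constrained;
this never happens for a plan that generates a trajectory. -/
def PlanRules.CycleSearch {Q A : Type*} (RP : PlanRules Q A)
    (pre suf : List (Fin (RP.k + 1))) : Prop :=
  (∃ i, RP.OnReachableCycle i ∧ (∀ i' < i, ¬ RP.OnReachableCycle i') ∧
      RP.IsShortestPath i i suf ∧ RP.IsShortestPath 0 i pre) ∨
    ∀ i, ¬ RP.OnReachableCycle i

/-- `i`, `j` occur consecutively in `s`. -/
def Consecutive {α : Type*} (s : List α) (i j : α) : Prop :=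
  ∃ n : ℕ, s[n]? = some i ∧ s[n + 1]? = some j

/-- `N'` is a possible result of the removal loops: `N' i` is obtained from `next i` by keeping,
from each non-empty class `C` of plan states in `next i` with the same label, exactly one
element `l`.  If `pre` passes from `i` into `C`, then `l` is such a successor of `i` in `pre`;
otherwise, if `suf` passes from `i` into `C`, then `l` is such a successor of `i` in `suf`;
otherwise `l` is an arbitrary element of `C`. -/
def PlanRules.Prunes {Q A : Type*} (RP : PlanRules Q A) (pre suf : List (Fin (RP.k + 1)))
    (N' : Fin (RP.k + 1) → Set (Fin (RP.k + 1))) : Prop :=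
  (∀ i, N' i ⊆ RP.next i) ∧
  ∀ i q, ∀ C : Set (Fin (RP.k + 1)), C = {j ∈ RP.next i | RP.world j = q} → C.Nonempty →
    ∃ l ∈ C, N' i ∩ C = {l} ∧
      ((∃ j ∈ C, Consecutive pre i j) → Consecutive pre i l) ∧
      ((¬ ∃ j ∈ C, Consecutive pre i j) → (∃ j ∈ C, Consecutive suf i j) → Consecutive suf i l)

/-- `RP'` is a possible output of the simplification algorithm on the plan `RP`. -/
def PlanRules.SimplifiesTo {Q A : Type*} (RP RP' : PlanRules Q A) : Prop :=
  ∃ pre suf N', RP.CycleSearch pre suf ∧ RP.Prunes pre suf N' ∧ RP' = { RP with next := N' }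

/-! ### The control strategy generated by a plan -/

open Classical in
/-- Follow a string of world states through the plan, from the plan state `i`: read the next
world state `q`, and move to some `j ∈ next i` labelled by `q`; fail if there is none. -/
noncomputable def PlanRules.follow {Q A : Type*} (RP : PlanRules Q A) :
    Fin (RP.k + 1) → List Q → Option (Fin (RP.k + 1))
  | i, [] => some i
  | i, q :: s => if h : ∃ j ∈ RP.next i, RP.world j = q then RP.follow h.choose s else none

open Classical in
/-- The strategy computed from the plan: the action of the plan state reached by following the
input string from the initial plan state, and the action of the initial plan state if the input
does not start with its label or cannot be followed. -/
noncomputable def PlanRules.functionStrategy {Q A : Type*} (RP : PlanRules Q A) :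
    ControlStrategy Q A := fun s =>
  if s.1.head s.2 = RP.world 0 then
    match RP.follow 0 s.1.tail with
    | some i => RP.act i
    | none => RP.act 0
  else RP.act 0

/-! ### The control strategy algorithm -/

/-- The runs of the main loop over a list of candidate initial states.  For the candidate `q`, the
planning step looks for a reactive plan of `(q, succ_T)` enforcing `φ`.  Either it finds none and
the loop goes on (a planner may fail at any candidate), or it yields any such plan, and then
the state `q` and the strategy computed from the simplified plan are returned.  The result `none`
stands for the answer `false`. -/
inductive AlternatingTS.LoopRun {Q A B O P : Type*} [Fintype A] (T : AlternatingTS Q A B O)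
    (φ : LTLX P) (val : Q → Set P) : List Q → Option (Q × ControlStrategy Q A) → Prop
  | exhausted : LoopRun T φ val [] none
  | notFound (q : Q) (qs : List Q) (r : Option (Q × ControlStrategy Q A)) :
      LoopRun T φ val qs r → LoopRun T φ val (q :: qs) r
  | found (q : Q) (qs : List Q) (RPkab RP : PlanRules Q A) :
      RPkab.IsReactivePlan (T.agent q) → RPkab.Satisfies φ val → RPkab.SimplifiesTo RP →
      LoopRun T φ val (q :: qs) (some (q, RP.functionStrategy))

/-- On input `T`, `φ`, `val`, the control strategy algorithm may return `r`; the main loop runs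
through all states, in some order. -/
def AlternatingTS.AlgorithmReturns {Q A B O P : Type*} [Fintype A] (T : AlternatingTS Q A B O)
    (φ : LTLX P) (val : Q → Set P) (r : Option (Q × ControlStrategy Q A)) : Prop :=
  ∃ order : List Q, order.Nodup ∧ (∀ q, q ∈ order) ∧ T.LoopRun φ val order r

/-! Every outcome of the returned strategy is a trajectory of the simplified plan, hence of the plan
found, and all trajectories of the latter satisfy `φ`. Two features of pruning suffice, whichever
cycle and representatives are chosen. It only removes edges, so no trajectory is added
(`SimplifiesTo.generates`). It keeps a representative of every successor label, so the result is
again a reactive plan (`SimplifiesTo.isReactivePlan`). The core is `generates_of_mem_Out`: along an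
outcome, the strategy plays the action of the plan state reached, which is labelled by the current
state. The next state is therefore a successor under that action, and the plan has a rule to move
to. Thus following never fails, and the plan states visited form the required run. -/

theorem AlternatingTS.agent_step_iff {Q A B O : Type*} [Fintype A] (T : AlternatingTS Q A B O)
    {q₀ q q' : Q} {a : A} : (T.agent q₀).Step q a q' ↔ ∃ b, T.trans q a b q' := by
  simp only [ReactiveAgent.Step, AlternatingTS.agent, AlternatingTS.succFun, List.mem_map,
    Finset.mem_toList, Finset.mem_univ, true_and, Prod.mk.injEq]
  constructor
  · rintro ⟨d, W, ⟨a', rfl, rfl, rfl⟩, h⟩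
    exact h
  · intro h
    exact ⟨_, _, ⟨a, rfl, rfl, rfl⟩, h⟩

/-- A pruned plan keeps, for every successor label of a plan state, some plan state with it. -/
theorem PlanRules.Prunes.exists_mem {Q A : Type*} {RP : PlanRules Q A}
    {pre suf : List (Fin (RP.k + 1))} {N' : Fin (RP.k + 1) → Set (Fin (RP.k + 1))}
    (h : RP.Prunes pre suf N') {i j : Fin (RP.k + 1)} (hj : j ∈ RP.next i) :
    ∃ l ∈ N' i, RP.world l = RP.world j := by
  obtain ⟨l, hlC, hl, -⟩ := h.2 i (RP.world j) _ rfl ⟨j, hj, rfl⟩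
  have hmem : l ∈ N' i ∩ {j' ∈ RP.next i | RP.world j' = RP.world j} := by
    rw [hl]; exact Set.mem_singleton l
  exact ⟨l, hmem.1, hlC.2⟩

/-- Simplification preserves reactive plans. -/
theorem PlanRules.SimplifiesTo.isReactivePlan {Q A : Type*} {RP RP' : PlanRules Q A}
    {R : ReactiveAgent Q A} (h : RP.SimplifiesTo RP') (hRP : RP.IsReactivePlan R) :
    RP'.IsReactivePlan R := by
  obtain ⟨pre, suf, N', -, hN, rfl⟩ := h
  refine ⟨hRP.world_init, hRP.executable, fun i j hj => hRP.step_of_next i j (hN.1 i hj), ?_⟩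
  intro i q' hq'
  obtain ⟨j, hj, rfl⟩ := hRP.next_of_step i q' hq'
  exact hN.exists_mem hj

/-- Simplification does not add trajectories. -/
theorem PlanRules.SimplifiesTo.generates {Q A : Type*} {RP RP' : PlanRules Q A}
    (h : RP.SimplifiesTo RP') {σ : ℕ → Q} (hσ : RP'.Generates σ) : RP.Generates σ := by
  obtain ⟨pre, suf, N', -, hN, rfl⟩ := h
  obtain ⟨n, hn0, hn⟩ := hσ
  exact ⟨n, hn0, fun j => ⟨hN.1 _ (hn j).1, (hn j).2⟩⟩

/-- Reading one more world state after a string that has been followed. -/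
theorem PlanRules.exists_follow_append {Q A : Type*} (RP : PlanRules Q A) {q : Q}
    {s : List Q} {i m : Fin (RP.k + 1)} (hm : RP.follow i s = some m)
    (hq : ∃ j ∈ RP.next m, RP.world j = q) :
    ∃ j ∈ RP.next m, RP.world j = q ∧ RP.follow i (s ++ [q]) = some j := by
  -- `follow` consumes its string from the front while `q` is added at the end, so the starting plan
  -- state has to vary.
  induction s generalizing i with
  | nil =>
    obtain rfl : i = m := by simpa [PlanRules.follow] using hm
    -- `follow` moves to the chosen element, so an arbitrary witness of `hq` would not do.
    exact ⟨hq.choose, hq.choose_spec.1, hq.choose_spec.2, by simp [PlanRules.follow, hq]⟩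
  | cons p s ih =>
    by_cases h : ∃ j ∈ RP.next i, RP.world j = p
    · rw [PlanRules.follow, dif_pos h] at hm
      rw [List.cons_append, PlanRules.follow, dif_pos h]
      exact ih hm
    · rw [PlanRules.follow, dif_neg h] at hm
      cases hm

/-- Tails appear because the strategy only tests the head against the initial label; `follow` reads
the rest. -/
theorem seqPrefix_succ_tail {Q : Type*} (σ : ℕ → Q) (i : ℕ) :
    (seqPrefix σ (i + 1)).1.tail = (seqPrefix σ i).1.tail ++ [σ (i + 1)] := by
  simp only [seqPrefix]
  rw [List.range_succ, List.map_append, List.tail_append_of_ne_nil (by simp)]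
  rfl

theorem seqPrefix_head {Q : Type*} (σ : ℕ → Q) (i : ℕ) :
    (seqPrefix σ i).1.head (seqPrefix σ i).2 = σ 0 := by
  simp [seqPrefix, List.head_range]

theorem PlanRules.functionStrategy_seqPrefix {Q A : Type*} (RP : PlanRules Q A) {σ : ℕ → Q}
    (h0 : σ 0 = RP.world 0) {i : ℕ} {m : Fin (RP.k + 1)}
    (hm : RP.follow 0 (seqPrefix σ i).1.tail = some m) :
    RP.functionStrategy (seqPrefix σ i) = RP.act m := by
  rw [PlanRules.functionStrategy, if_pos ((seqPrefix_head σ i).trans h0), hm]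

/-- The outcomes of the strategy computed from a reactive plan are trajectories of the plan. -/
theorem PlanRules.IsReactivePlan.generates_of_mem_Out {Q A B O : Type*} [Fintype A]
    {T : AlternatingTS Q A B O} {q₀ : Q} {RP : PlanRules Q A}
    (hRP : RP.IsReactivePlan (T.agent q₀)) {σ : ℕ → Q}
    (hσ : σ ∈ T.Out q₀ RP.functionStrategy) : RP.Generates σ := by
  have h0 : σ 0 = RP.world 0 := hσ.1.trans hRP.world_init.symm
  have hstep : ∀ i m, RP.follow 0 (seqPrefix σ i).1.tail = some m → RP.world m = σ i →
      ∃ j ∈ RP.next m, RP.world j = σ (i + 1) ∧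
        RP.follow 0 (seqPrefix σ (i + 1)).1.tail = some j := by
    intro i m hm hw
    have htrans := hσ.2 i
    rw [RP.functionStrategy_seqPrefix h0 hm, ← hw] at htrans
    rw [seqPrefix_succ_tail]
    exact RP.exists_follow_append hm
      (hRP.next_of_step m _ (T.agent_step_iff.mpr htrans))
  -- The label equation is carried along because `hstep` needs it to turn a transition from `σ i`
  -- into one from the label of `m`.
  have hex : ∀ i, ∃ m, RP.follow 0 (seqPrefix σ i).1.tail = some m ∧ RP.world m = σ i := by
    intro i
    induction i with
    | zero => exact ⟨0, by simp [seqPrefix, PlanRules.follow], h0.symm⟩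
    | succ i ih =>
      obtain ⟨m, hm, hw⟩ := ih
      obtain ⟨j, -, hj, hf⟩ := hstep i m hm hw
      exact ⟨j, hf, hj⟩
  choose n hn hw using hex
  refine ⟨n, ?_, fun i => ⟨?_, hw i⟩⟩
  · simpa [seqPrefix, PlanRules.follow, eq_comm] using hn 0
  -- The states `n i` were chosen independently for each `i`; since `follow` is a function, `n (i +
  -- 1)` must be the successor `j` of `n i`.
  · obtain ⟨j, hj, -, hf⟩ := hstep i (n i) (hn i) (hw i)
    rw [hn (i + 1), Option.some.injEq] at hf
    rwa [hf]

/-- A successful run of the main loop returns the strategy of a simplified enforcing plan. -/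
theorem AlternatingTS.LoopRun.exists_plan {Q A B O P : Type*} [Fintype A]
    {T : AlternatingTS Q A B O} {φ : LTLX P} {val : Q → Set P} {qs : List Q}
    {r : Option (Q × ControlStrategy Q A)} (h : T.LoopRun φ val qs r) {q₀ : Q}
    {f : ControlStrategy Q A} (hr : r = some (q₀, f)) :
    ∃ RPkab RP : PlanRules Q A, RPkab.IsReactivePlan (T.agent q₀) ∧ RPkab.Satisfies φ val ∧
      RPkab.SimplifiesTo RP ∧ f = RP.functionStrategy := by
  -- Keeping the result as a variable `r` with the equation `hr` lets the induction run over a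
  -- general index.
  induction h with
  | exhausted => cases hr
  | notFound _ _ _ _ ih => exact ih hr
  | found q qs RPkab RP hplan hsat hsimp =>
    cases hr
    exact ⟨RPkab, RP, hplan, hsat, hsimp, rfl⟩

theorem mainTheorem2 {Q A B O P : Type*} [Fintype Q] [Fintype A] [Fintype B] [Fintype P]
    (T : AlternatingTS Q A B O) (hT : T.NonBlocking) (φ : LTLX P) (val : Q → Set P)
    (q₀ : Q) (f : ControlStrategy Q A) (hret : T.AlgorithmReturns φ val (some (q₀, f))) :
    ∀ σ ∈ T.Out q₀ f, φ.SatisfiedBy val σ := by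
  intro σ hσ
  obtain ⟨order, -, -, hrun⟩ := hret
  obtain ⟨RPkab, RP, hplan, hsat, hsimp, rfl⟩ := hrun.exists_plan rfl
  exact hsat.1 σ (hsimp.generates ((hsimp.isReactivePlan hplan).generates_of_mem_Out hσ))
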